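/- An $r$-graph $G$ consists of a finite vertex set $V(G)$ and a set $E(G)$ of $r$-element subsets of $V(G)$; its order is $|V(G)|$ and its density is $|E(G)|/\binom{|V(G)|}{r}$. A number $\alpha\in[0,1)$ is called a jump for $r$-graphs if there is $\delta>0$ such that for every $\varepsilon>0$ and every integer $n\ge r$ there is $N$ such that every $r$-graph of order at least $N$ and density at least $\alpha+\varepsilon$ has a subgraph of order $n$ and density at least $\alpha+\delta$; otherwise $\alpha\in[0,1)$ is called a non-jump for $r$-graphs. Theorem. For every integer $r\ge 4$, the number $\frac{2\cdot r!}{r^r}$ lies in $[0,1)$ and is a non-jump for $r$-graphs. -/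

import Mathlib

namespace Hypergraph

/-- `G` is an `r`-graph: an `r`-uniform hypergraph with finitely many vertices. -/
structure IsRGraph {V : Type*} (r : ℕ) (G : Hypergraph V) : Prop where
  finite_vertexSet : G.vertexSet.Finite
  ncard_edge : ∀ e ∈ G.edgeSet, e.ncard = r

/-- The order of `G`, i.e. its number of vertices. -/
noncomputable def order {V : Type*} (G : Hypergraph V) : ℕ :=
  G.vertexSet.ncard

/-- The density of an `r`-graph `G`: the number of edges divided by the number of `r`-element
subsets of the vertex set. -/
noncomputable def density {V : Type*} (r : ℕ) (G : Hypergraph V) : ℝ :=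
  (G.edgeSet.ncard : ℝ) / (G.order.choose r : ℝ)

/-- `H` is a (not necessarily induced) subgraph of `G`. -/
def IsSubgraph {V : Type*} (H G : Hypergraph V) : Prop :=
  H.vertexSet ⊆ G.vertexSet ∧ H.edgeSet ⊆ G.edgeSet

end Hypergraph

/-- `α` is a jump for `r`-graphs: there is `δ > 0` such that for all `ε > 0` and `n ≥ r`, every
sufficiently large `r`-graph of density at least `α + ε` has a subgraph of order `n` and density
at least `α + δ`. (The requirement `α ∈ [0, 1)` is not included here.) -/
def IsJump (r : ℕ) (α : ℝ) : Prop :=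
  ∃ δ : ℝ, 0 < δ ∧ ∀ ε : ℝ, 0 < ε → ∀ n : ℕ, r ≤ n →
    ∃ N : ℕ, ∀ (V : Type) (G : Hypergraph V), G.IsRGraph r → N ≤ G.order →
      α + ε ≤ G.density r →
        ∃ H : Hypergraph V, H.IsSubgraph G ∧ H.order = n ∧ α + δ ≤ H.density r

/-! Write r = k + 2 and α = 2·r!/r^r. Take k left classes of size tq and 2t right classes of size q;
the edges meeting every left class and two right classes number (2t^(k+2) - t^(k+1))q^r on rtq
vertices, whereas 2t^(k+2)q^r would guarantee density α. Adding the edges over a family `R` of more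
than t^(k+1) r-sets of right classes covers the deficit, with a surplus independent of q.

The family is invisible to n vertices if any j ≤ n right classes contain at most j - (k+1) members
of `R`; the deletion method provides it (`exists_isLocallySparse`). Then n vertices span at most
2n^r/r^r edges (`IsLocallySparse.pattern_sum_le`): `R` contributes much only if the weight
concentrates on k + 1 right classes, which lowers the number of pairs (`pattern_polynomial_le`).

Since C(n,r) ~ n^r/r!, a large n brings the density of such subgraphs below α + δ. The choices are
made in the order δ, n, then t and `R`, then ε, N, q. -/

/-! ### AM-GM and the polynomial inequality -/

theorem prod_le_average_pow {ι : Type*} (s : Finset ι) (f : ι → ℝ) (hf : ∀ i ∈ s, 0 ≤ f i) :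
    ∏ i ∈ s, f i ≤ ((∑ i ∈ s, f i) / s.card) ^ s.card := by
  rcases s.eq_empty_or_nonempty with rfl | hs
  · simp
  have hc : (0 : ℝ) < s.card := by exact_mod_cast hs.card_pos
  have h := Real.geom_mean_le_arith_mean s (fun _ => 1) f (by simp) (by simpa using hs) hf
  simp only [Real.rpow_one, Finset.sum_const, nsmul_eq_mul, mul_one, one_mul] at h
  have h0 : 0 ≤ ∏ i ∈ s, f i := Finset.prod_nonneg hf
  calc ∏ i ∈ s, f i = ((∏ i ∈ s, f i) ^ ((s.card : ℝ)⁻¹)) ^ s.card :=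
        (Real.rpow_inv_natCast_pow h0 hs.card_ne_zero).symm
    _ ≤ _ := pow_le_pow_left₀ (Real.rpow_nonneg h0 _) h _

theorem pow_mul_le_average_pow (j : ℕ) {a b : ℝ} (ha : 0 ≤ a) (hb : 0 ≤ b) :
    a ^ j * b ≤ ((j * a + b) / (j + 1)) ^ (j + 1) := by
  have h := prod_le_average_pow Finset.univ (Fin.cons b fun _ : Fin j => a)
    (fun i _ => by refine Fin.cases ?_ (fun i => ?_) i <;> simpa)
  simp only [Fin.prod_univ_succ, Fin.sum_univ_succ, Fin.cons_zero, Fin.cons_succ, Finset.prod_const,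
    Finset.sum_const, Finset.card_univ, Fintype.card_fin, nsmul_eq_mul, Nat.cast_add,
    Nat.cast_one] at h
  rwa [mul_comm, add_comm (j * a : ℝ)]

theorem pow_mul_sq_le_average_pow (j : ℕ) {a b : ℝ} (ha : 0 ≤ a) (hb : 0 ≤ b) :
    a ^ j * b ^ 2 ≤ ((j * a + 2 * b) / (j + 2)) ^ (j + 2) := by
  have h := prod_le_average_pow Finset.univ
    (Fin.cons b (Fin.cons b fun _ : Fin j => a) : Fin (j + 2) → ℝ)
    (fun i _ => by
      refine Fin.cases ?_ (fun i => ?_) i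
      · simpa
      · refine Fin.cases ?_ (fun i => ?_) i <;> simpa)
  simp only [Fin.prod_univ_succ, Fin.sum_univ_succ, Fin.cons_zero, Fin.cons_succ, Finset.prod_const,
    Finset.sum_const, Finset.card_univ, Fintype.card_fin, nsmul_eq_mul, Nat.cast_add] at h
  calc a ^ j * b ^ 2 = b * (b * a ^ j) := by ring
    _ ≤ _ := h
    _ = _ := by ring

/-- This controls the first term of `half_mul_sq_add_pow_le` at s = 1/2: the constant 63/32 leaves
exactly (1/2)^5 for the second term. It fails at k = 2, where 256 > 252. -/
theorem add_two_pow_le (k : ℕ) (hk : 3 ≤ k) :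
    ((k : ℝ) + 2) ^ (k + 2) ≤ 63 / 32 * 2 ^ (k + 3) * (k : ℝ) ^ k := by
  -- The estimate (1 + 2/k)^k ≤ e² < 7.4 suffices only from k = 5 on.
  rcases Nat.lt_or_ge k 5 with h5 | h5
  · interval_cases k <;> norm_num
  have hk0 : (0 : ℝ) < k := by positivity
  have h1 : ((k : ℝ) + 2) ^ k ≤ 7.4 * (k : ℝ) ^ k := by
    have h2 : 1 + 2 / (k : ℝ) ≤ Real.exp (2 / k) := by
      rw [add_comm]; exact Real.add_one_le_exp _
    have h3 : (1 + 2 / (k : ℝ)) ^ k ≤ 7.4 := by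
      calc (1 + 2 / (k : ℝ)) ^ k ≤ Real.exp (2 / k) ^ k := pow_le_pow_left₀ (by positivity) h2 _
        _ = Real.exp 1 ^ 2 := by
          rw [← Real.exp_nat_mul, ← Real.exp_nat_mul]; congr 1; field_simp; norm_num
        _ ≤ 2.7182818286 ^ 2 := pow_le_pow_left₀ (Real.exp_pos _).le Real.exp_one_lt_d9.le _
        _ ≤ 7.4 := by norm_num
    calc ((k : ℝ) + 2) ^ k = (1 + 2 / (k : ℝ)) ^ k * (k : ℝ) ^ k := by
          rw [← mul_pow]; congr 1; field_simp
      _ ≤ _ := by gcongr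
  have h2 : 7.4 * ((k : ℝ) + 2) ^ 2 ≤ 63 / 32 * 2 ^ (k + 3) := by
    clear h1 hk hk0
    induction k, h5 using Nat.le_induction with
    | base => norm_num
    | succ n hn ih =>
      have : (5 : ℝ) ≤ n := by exact_mod_cast hn
      have h2 : (2 : ℝ) ^ (n + 1 + 3) = 2 * 2 ^ (n + 3) := by ring
      rw [h2]; push_cast; nlinarith
  calc ((k : ℝ) + 2) ^ (k + 2) = ((k : ℝ) + 2) ^ k * ((k : ℝ) + 2) ^ 2 := by ring
    _ ≤ 7.4 * (k : ℝ) ^ k * ((k : ℝ) + 2) ^ 2 := by gcongr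
    _ = 7.4 * ((k : ℝ) + 2) ^ 2 * (k : ℝ) ^ k := by ring
    _ ≤ _ := by gcongr

/-- After multiplication by (k+2)^(k+2), the terms are at most 63/16·(1 - s) and the chord of s^5
over [1/2, 1]. These add up to 3 - 2s ≤ 2. -/
theorem half_mul_sq_add_pow_le {k : ℕ} (hk : 3 ≤ k) {s : ℝ} (hs : 1 / 2 ≤ s) (hs1 : s ≤ 1) :
    ((1 - s) / k) ^ k * (s ^ 2 / 2) + (s / (k + 2)) ^ (k + 2) ≤ 2 / ((k : ℝ) + 2) ^ (k + 2) := by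
  have hk0 : (0 : ℝ) < k := by positivity
  have h1 : s ^ 2 * (1 - s) ^ k ≤ (1 / 2) ^ (k + 1) * (1 - s) := by
    obtain ⟨j, rfl⟩ := Nat.exists_eq_add_of_le hk
    have h0 : 0 ≤ 1 - s := by linarith
    calc s ^ 2 * (1 - s) ^ (3 + j) = (s * (1 - s)) ^ 2 * (1 - s) ^ j * (1 - s) := by ring
      _ ≤ (1 / 4) ^ 2 * (1 / 2) ^ j * (1 - s) := by
        gcongr
        · nlinarith [sq_nonneg (s - 1 / 2)]
        · linarith
      _ = _ := by ring
  have h2 : s ^ (k + 2) ≤ 1 / 32 + 31 / 16 * (s - 1 / 2) := by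
    have h3 : s ^ (k + 2) ≤ s ^ 5 := pow_le_pow_of_le_one (by linarith) hs1 (by omega)
    have h4 : s ^ 2 ≤ (3 * s - 1) / 2 := by nlinarith
    have h5 : s ^ 3 ≤ (7 * s - 3) / 4 := by nlinarith
    have h6 : s ^ 5 ≤ 1 / 32 + 31 / 16 * (s - 1 / 2) := by
      have : s ^ 5 = s ^ 2 * s ^ 3 := by ring
      have h7 : s ^ 2 * s ^ 3 ≤ s ^ 2 * ((7 * s - 3) / 4) := by gcongr
      nlinarith
    linarith
  have h3 := add_two_pow_le k hk
  rw [le_div_iff₀ (by positivity)]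
  have h4 : ((1 - s) / k) ^ k * (s ^ 2 / 2) * ((k : ℝ) + 2) ^ (k + 2) ≤ 63 / 16 * (1 - s) := by
    rw [div_pow]
    have e : (1 - s) ^ k / (k : ℝ) ^ k * (s ^ 2 / 2) * ((k : ℝ) + 2) ^ (k + 2) =
      (s ^ 2 * (1 - s) ^ k) * (((k : ℝ) + 2) ^ (k + 2) / (k : ℝ) ^ k) / 2 := by field_simp
    rw [e]
    have h5 : ((k : ℝ) + 2) ^ (k + 2) / (k : ℝ) ^ k ≤ 63 / 32 * 2 ^ (k + 3) := by
      rwa [div_le_iff₀ (by positivity)]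
    have h6 : (0 : ℝ) ≤ 1 - s := by linarith
    calc (s ^ 2 * (1 - s) ^ k) * (((k : ℝ) + 2) ^ (k + 2) / (k : ℝ) ^ k) / 2
        ≤ ((1 / 2) ^ (k + 1) * (1 - s)) * (63 / 32 * 2 ^ (k + 3)) / 2 := by gcongr
      _ = 63 / 16 * (1 - s) * ((1 / 2) ^ (k + 1) * 2 ^ (k + 1)) := by ring
      _ = _ := by rw [← mul_pow]; norm_num
  have h5 : (s / ((k : ℝ) + 2)) ^ (k + 2) * ((k : ℝ) + 2) ^ (k + 2) = s ^ (k + 2) := by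
    rw [← mul_pow]; congr 1; field_simp
  rw [add_mul, h5]
  linarith

/-- The polynomial inequality behind the bound on small subgraphs of the blow-up. -/
theorem pattern_polynomial_le {k : ℕ} (hk : 2 ≤ k) {s A : ℝ} (hs1 : s ≤ 1)
    (hA : 0 ≤ A) (hAs : (k + 1) * A ≤ s) :
    ((1 - s) / k) ^ k * ((s ^ 2 - (k + 1) * A ^ 2) / 2) + A ^ (k + 1) * (s - (k + 1) * A) ≤
      2 / ((k : ℝ) + 2) ^ (k + 2) := by
  have hk0 : (0 : ℝ) < k := by positivity
  have hs : 0 ≤ s := le_trans (by positivity) hAs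
  set w := s - (k + 1) * A with hw
  have hw0 : 0 ≤ w := by linarith
  set P := ((1 - s) / k) ^ k with hP
  have hP0 : 0 ≤ P := pow_nonneg (div_nonneg (by linarith) hk0.le) _
  have e : A ^ (k + 1) = A ^ 2 * A ^ (k - 1) := by rw [← pow_add]; congr 1; omega
  -- At the threshold, the gain A^(k+1)·w equals the loss P(k+1)A²/2 in the pair term. Below it, A
  -- drops out, and AM-GM on k copies of (1-s)/k and two of s/2 finishes.
  rcases le_or_gt (A ^ (k - 1) * w) ((k + 1) * P / 2) with h | h
  · have h1 : A ^ (k + 1) * w ≤ A ^ 2 * ((k + 1) * P / 2) := by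
      rw [e, mul_assoc]; gcongr
    have h2 := pow_mul_sq_le_average_pow k (a := (1 - s) / k) (b := s / 2)
      (div_nonneg (by linarith) hk0.le) (by linarith)
    have h3 : (k * ((1 - s) / k) + 2 * (s / 2)) / ((k : ℝ) + 2) = 1 / (k + 2) := by
      field_simp; ring
    rw [h3, div_pow 1, one_pow] at h2
    have h4 : 2 / ((k : ℝ) + 2) ^ (k + 2) = 2 * (1 / ((k : ℝ) + 2) ^ (k + 2)) := by ring
    rw [h4]
    nlinarith
  -- Above it, the loss is discarded: `h` makes P small, which pushes s well beyond the extremal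
  -- value 2/(k+2).
  · have h1 : A ^ (k + 1) * w ≤ (s / (k + 2)) ^ (k + 2) := by
      have := pow_mul_le_average_pow (k + 1) hA hw0
      convert this using 2
      push_cast
      rw [hw]; ring
    have h2 : P * ((s ^ 2 - (k + 1) * A ^ 2) / 2) ≤ P * (s ^ 2 / 2) := by
      gcongr; nlinarith [sq_nonneg A]
    refine le_trans (add_le_add h2 h1) ?_
    rcases hk.eq_or_lt with rfl | hk3
    -- For k = 2, s ≥ 1/2 would not be enough. The sharper A(s - 3A) ≤ s²/12 gives s ≥ 2/3; then the
    -- tangent of s(1-s) at 2/3 and the chords of s² and s^4 over [2/3, 1] reduce the claim to a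
    -- linear one.
    · norm_num at h hP hw ⊢
      have h3 : (1 - s) ^ 2 < 2 / 9 * s ^ 2 := by
        rw [hP] at h; rw [hw] at h
        have : A * (s - 3 * A) ≤ s ^ 2 / 12 := by nlinarith [sq_nonneg (s - 6 * A)]
        have : ((1 - s) / 2) ^ 2 = (1 - s) ^ 2 / 4 := by ring
        linarith
      have h4 : 2 / 3 ≤ s := by
        by_contra hlt
        push Not at hlt
        have h5 : s ^ 2 ≤ (2 / 3) ^ 2 := by gcongr
        have h6 : (1 / 3) ^ 2 ≤ (1 - s) ^ 2 := by gcongr; linarith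
        linarith
      rw [hP]
      have h5 : s * (1 - s) ≤ 2 / 9 - (s - 2 / 3) / 3 := by nlinarith
      have h6 : (s * (1 - s)) ^ 2 ≤ 2 / 9 * (2 / 9 - (s - 2 / 3) / 3) := by
        have : 0 ≤ s * (1 - s) := mul_nonneg hs (by linarith)
        nlinarith
      have h7 : s ^ 4 ≤ 16 / 81 + 65 / 27 * (s - 2 / 3) := by
        have : s ^ 2 ≤ 4 / 9 + 5 / 3 * (s - 2 / 3) := by nlinarith
        have h8 : s ^ 4 ≤ (4 / 9 + 5 / 3 * (s - 2 / 3)) ^ 2 := by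
          calc s ^ 4 = (s ^ 2) ^ 2 := by ring
            _ ≤ _ := by gcongr
        nlinarith
      nlinarith
    · refine half_mul_sq_add_pow_le hk3 ?_ hs1
      have h3 : A ^ (k - 1) * w ≤ (s / k) ^ k := by
        obtain ⟨j, rfl⟩ : ∃ j, k = j + 1 := ⟨k - 1, by omega⟩
        refine (pow_mul_le_average_pow j hA hw0).trans ?_
        push_cast
        gcongr
        rw [hw]; push_cast; nlinarith
      have h4 : P < (s / k) ^ k := by
        have : (3 : ℝ) ≤ k := by exact_mod_cast hk3
        nlinarith
      have h5 := lt_of_pow_lt_pow_left₀ k (by positivity) h4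
      rw [div_lt_div_iff_of_pos_right hk0] at h5
      linarith

/-! ### Locally sparse families and edge counts of small subgraphs -/

theorem sum_powersetCard_two_prod {ι : Type*} [DecidableEq ι] (s : Finset ι) (f : ι → ℝ) :
    ∑ p ∈ s.powersetCard 2, ∏ i ∈ p, f i = ((∑ i ∈ s, f i) ^ 2 - ∑ i ∈ s, f i ^ 2) / 2 := by
  induction s using Finset.induction_on with
  | empty =>
    rw [Finset.powersetCard_eq_empty.2 (by simp)]
    simp
  | insert a s ha ih =>
    have hd : Disjoint (s.powersetCard 2) ((s.powersetCard 1).image (insert a)) := by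
      rw [Finset.disjoint_left]
      intro p hp hp'
      obtain ⟨q, -, rfl⟩ := Finset.mem_image.1 hp'
      exact ha ((Finset.mem_powersetCard.1 hp).1 (Finset.mem_insert_self _ _))
    rw [Finset.powersetCard_succ_insert ha, Finset.sum_union hd, ih, Finset.sum_image,
      Finset.powersetCard_one, Finset.sum_map, Finset.sum_insert ha, Finset.sum_insert ha]
    · have : ∑ x ∈ s, ∏ i ∈ insert a {x}, f i = f a * ∑ x ∈ s, f x := by
        rw [Finset.mul_sum]
        refine Finset.sum_congr rfl fun x hx => ?_
        rw [Finset.prod_insert, Finset.prod_singleton]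
        rw [Finset.mem_singleton]
        rintro rfl
        exact ha hx
      simp only [Function.Embedding.coeFn_mk]
      rw [this]; ring
    · intro p hp q hq h
      have hp' : a ∉ p := fun h' => ha ((Finset.mem_powersetCard.1 hp).1 h')
      have hq' : a ∉ q := fun h' => ha ((Finset.mem_powersetCard.1 hq).1 h')
      rw [← Finset.erase_insert hp', h, Finset.erase_insert hq']

/-- Every set of `j ≤ n` vertices contains at most `j - d` members of `R`. -/
def IsLocallySparse {ι : Type*} [DecidableEq ι] (d n : ℕ) (R : Finset (Finset ι)) : Prop :=
  ∀ S : Finset ι, S.card ≤ n → (R.filter (· ⊆ S)).card ≤ S.card - d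

theorem card_filter_range_lt {a N : ℕ} (h : a ≤ N) :
    ((Finset.range N).filter (· < a)).card = a := by
  have : (Finset.range N).filter (· < a) = Finset.range a := by
    ext u; simp only [Finset.mem_filter, Finset.mem_range]; omega
  rw [this, Finset.card_range]

/-- Layer-cake summation. At level u, the members with `μ E > u` lie inside S = {w > u}, which has
at most n vertices, so there are at most |S| - d ≤ |S \ T| of them. -/
theorem IsLocallySparse.sum_le {ι : Type*} [Fintype ι] [DecidableEq ι] {d n : ℕ}
    {R : Finset (Finset ι)} (hR : IsLocallySparse d n R) (hne : ∀ E ∈ R, E.Nonempty) (w : ι → ℕ)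
    (hw : (Finset.univ.filter (0 < w ·)).card ≤ n) (μ : Finset ι → ℕ)
    (hμ : ∀ E ∈ R, ∀ v ∈ E, μ E ≤ w v) {T : Finset ι} (hT : T.card = d) :
    ∑ E ∈ R, μ E ≤ ∑ v ∈ Tᶜ, w v := by
  set N := ∑ v, w v
  have hN : ∀ v, w v ≤ N := fun v => Finset.single_le_sum (fun _ _ => Nat.zero_le _)
    (Finset.mem_univ v)
  have hμN : ∀ E ∈ R, μ E ≤ N := fun E hE => by
    obtain ⟨v, hv⟩ := hne E hE
    exact (hμ E hE v hv).trans (hN v)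
  calc ∑ E ∈ R, μ E = ∑ E ∈ R, ((Finset.range N).filter (· < μ E)).card :=
        Finset.sum_congr rfl fun E hE => (card_filter_range_lt (hμN E hE)).symm
    _ = ∑ u ∈ Finset.range N, (R.filter (u < μ ·)).card := by
        simp only [Finset.card_filter]
        exact Finset.sum_comm
    _ ≤ ∑ u ∈ Finset.range N, (Tᶜ.filter (u < w ·)).card := by
        refine Finset.sum_le_sum fun u _ => ?_
        set S := Finset.univ.filter (u < w ·) with hS
        calc (R.filter (u < μ ·)).card ≤ (R.filter (· ⊆ S)).card := by
              refine Finset.card_le_card fun E hE => ?_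
              rw [Finset.mem_filter] at hE ⊢
              refine ⟨hE.1, fun v hv => ?_⟩
              rw [hS, Finset.mem_filter]
              exact ⟨Finset.mem_univ _, hE.2.trans_le (hμ E hE.1 v hv)⟩
          _ ≤ S.card - d := hR S <| (Finset.card_le_card fun v hv => by
              rw [hS, Finset.mem_filter] at hv
              rw [Finset.mem_filter]
              exact ⟨hv.1, by omega⟩).trans hw
          _ ≤ (S \ T).card := by rw [← hT]; exact Finset.le_card_sdiff _ _
          _ ≤ _ := Finset.card_le_card fun v hv => by
              rw [Finset.mem_sdiff, hS, Finset.mem_filter] at hv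
              rw [Finset.mem_filter, Finset.mem_compl]
              exact ⟨hv.2, hv.1.2⟩
    _ = ∑ v ∈ Tᶜ, ((Finset.range N).filter (· < w v)).card := by
        simp only [Finset.card_filter]
        exact Finset.sum_comm
    _ = _ := Finset.sum_congr rfl fun v _ => card_filter_range_lt (hN v)

/-- Let T maximise the product over d-sets. Removing a vertex of least weight from E leaves d
vertices, whose product is at most that of T; `sum_le` adds up the removed weights. -/
theorem IsLocallySparse.exists_sum_prod_le {ι : Type*} [Fintype ι] [DecidableEq ι] {d n : ℕ}
    {R : Finset (Finset ι)} (hR : IsLocallySparse d n R) (hcard : ∀ E ∈ R, E.card = d + 1)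
    (w : ι → ℕ) (hw : (Finset.univ.filter (0 < w ·)).card ≤ n) (hd : d ≤ Fintype.card ι) :
    ∃ T : Finset ι, T.card = d ∧
      ∑ E ∈ R, ∏ v ∈ E, w v ≤ (∏ v ∈ T, w v) * ∑ v ∈ Tᶜ, w v := by
  obtain ⟨T, hT, hmax⟩ := (Finset.univ.powersetCard d).exists_max_image (fun T => ∏ v ∈ T, w v)
    (Finset.powersetCard_nonempty.2 (by simpa using hd))
  have hTd := (Finset.mem_powersetCard.1 hT).2
  refine ⟨T, hTd, ?_⟩
  have hne : ∀ E ∈ R, E.Nonempty := fun E hE => by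
    rw [← Finset.card_pos, hcard E hE]; omega
  have key : ∀ E ∈ R, ∃ m, (∀ v ∈ E, m ≤ w v) ∧ ∏ v ∈ E, w v ≤ (∏ v ∈ T, w v) * m := by
    intro E hE
    obtain ⟨v, hv, hmin⟩ := E.exists_min_image w (hne E hE)
    refine ⟨w v, hmin, ?_⟩
    rw [← Finset.prod_erase_mul E w hv]
    refine Nat.mul_le_mul_right _ (hmax _ ?_)
    rw [Finset.mem_powersetCard, Finset.card_erase_of_mem hv, hcard E hE]
    exact ⟨Finset.subset_univ _, rfl⟩
  choose! μ hμ hμ' using key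
  calc ∑ E ∈ R, ∏ v ∈ E, w v ≤ ∑ E ∈ R, (∏ v ∈ T, w v) * μ E := Finset.sum_le_sum hμ'
    _ = (∏ v ∈ T, w v) * ∑ E ∈ R, μ E := (Finset.mul_sum _ _ _).symm
    _ ≤ _ := Nat.mul_le_mul_left _ (hR.sum_le hne w hw μ hμ hTd)

/-- Integer weights of total n have at most n nonzero values, so sparsity up to n suffices. After
scaling by n, s is the right-hand share and A the mean share of a class in T; Cauchy–Schwarz on T
gives the loss in the pair term. -/
theorem IsLocallySparse.pattern_sum_le {ι : Type*} [Fintype ι] [DecidableEq ι] {k n : ℕ}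
    (hk : 2 ≤ k) (hn : 0 < n) {R : Finset (Finset ι)} (hR : IsLocallySparse (k + 1) n R)
    (hcard : ∀ E ∈ R, E.card = k + 2) (hι : k + 1 ≤ Fintype.card ι)
    (x : Fin k → ℕ) (w : ι → ℕ) (hxw : ∑ j, x j + ∑ v, w v = n) :
    (((∏ j, x j) * ∑ p ∈ Finset.univ.powersetCard 2, ∏ v ∈ p, w v +
      ∑ E ∈ R, ∏ v ∈ E, w v : ℕ) : ℝ) ≤ 2 * (n : ℝ) ^ (k + 2) / ((k : ℝ) + 2) ^ (k + 2) := by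
  have hsupp : (Finset.univ.filter (0 < w ·)).card ≤ n := by
    calc (Finset.univ.filter (0 < w ·)).card = ∑ v ∈ Finset.univ.filter (0 < w ·), 1 := by simp
      _ ≤ ∑ v ∈ Finset.univ.filter (0 < w ·), w v :=
        Finset.sum_le_sum fun v hv => (Finset.mem_filter.1 hv).2
      _ ≤ ∑ v, w v := Finset.sum_le_sum_of_subset (Finset.subset_univ _)
      _ ≤ n := by omega
  obtain ⟨T, hT, hsum⟩ := hR.exists_sum_prod_le hcard w hsupp hι
  have hn0 : (0 : ℝ) < n := by exact_mod_cast hn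
  have hk0 : (0 : ℝ) < k := by positivity
  set S : ℝ := ∑ v, (w v : ℝ) with hS
  set U : ℝ := ∑ v ∈ T, (w v : ℝ) with hU
  have hxw' : ∑ j, (x j : ℝ) + S = n := by rw [hS]; exact_mod_cast hxw
  have hx0 : 0 ≤ ∑ j, (x j : ℝ) := by positivity
  have hU0 : 0 ≤ U := by positivity
  have hUS : U + ∑ v ∈ Tᶜ, (w v : ℝ) = S := Finset.sum_add_sum_compl T _
  have hc0 : 0 ≤ ∑ v ∈ Tᶜ, (w v : ℝ) := by positivity
  have main := pattern_polynomial_le hk (s := S / n) (A := U / (k + 1) / n)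
    (by rw [div_le_one hn0]; linarith) (by positivity) (by
      have : ((k : ℝ) + 1) * (U / (k + 1) / n) = U / n := by field_simp
      rw [this]; gcongr; linarith)
  have h1 : ∏ j, (x j : ℝ) ≤ (n : ℝ) ^ k * ((1 - S / n) / k) ^ k := by
    have := prod_le_average_pow Finset.univ (fun j => (x j : ℝ)) (by simp)
    rw [Finset.card_univ, Fintype.card_fin] at this
    refine this.trans_eq ?_
    rw [← mul_pow, eq_sub_iff_add_eq.2 hxw']
    congr 1
    field_simp
  have h2 : ∑ p ∈ Finset.univ.powersetCard 2, ∏ v ∈ p, (w v : ℝ) ≤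
      (n : ℝ) ^ 2 * (((S / n) ^ 2 - (k + 1) * (U / (k + 1) / n) ^ 2) / 2) := by
    rw [sum_powersetCard_two_prod]
    have h3 : U ^ 2 ≤ (k + 1) * ∑ v ∈ T, (w v : ℝ) ^ 2 := by
      have := sq_sum_le_card_mul_sum_sq (s := T) (f := fun v => (w v : ℝ))
      rw [hT] at this
      push_cast at this
      exact this
    have h4 : ∑ v ∈ T, (w v : ℝ) ^ 2 ≤ ∑ v, (w v : ℝ) ^ 2 :=
      Finset.sum_le_sum_of_subset_of_nonneg (Finset.subset_univ _) fun _ _ _ => by positivity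
    have h5 : U ^ 2 / (k + 1) ≤ ∑ v, (w v : ℝ) ^ 2 := by
      rw [div_le_iff₀ (by positivity)]; nlinarith
    have h6 : (n : ℝ) ^ 2 * (((S / n) ^ 2 - (k + 1) * (U / (k + 1) / n) ^ 2) / 2) =
        (S ^ 2 - U ^ 2 / (k + 1)) / 2 := by field_simp
    rw [h6]
    linarith
  have h3 : ∑ E ∈ R, ∏ v ∈ E, (w v : ℝ) ≤
      (n : ℝ) ^ (k + 2) * ((U / (k + 1) / n) ^ (k + 1) * (S / n - (k + 1) * (U / (k + 1) / n))) := by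
    have h4 : ∑ E ∈ R, ∏ v ∈ E, (w v : ℝ) ≤ (∏ v ∈ T, (w v : ℝ)) * ∑ v ∈ Tᶜ, (w v : ℝ) := by
      exact_mod_cast hsum
    have h5 : ∏ v ∈ T, (w v : ℝ) ≤ (U / (k + 1)) ^ (k + 1) := by
      have := prod_le_average_pow T (fun v => (w v : ℝ)) (by simp)
      rw [hT] at this
      push_cast at this
      exact this
    refine h4.trans ?_
    calc (∏ v ∈ T, (w v : ℝ)) * ∑ v ∈ Tᶜ, (w v : ℝ)
        ≤ (U / (k + 1)) ^ (k + 1) * ∑ v ∈ Tᶜ, (w v : ℝ) := by gcongr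
      _ = (U / (k + 1)) ^ (k + 1) * (S - U) := by rw [← hUS]; ring
      _ = _ := by rw [div_pow (U / (k + 1))]; field_simp; ring
  push_cast
  calc (∏ j, (x j : ℝ)) * ∑ p ∈ Finset.univ.powersetCard 2, ∏ v ∈ p, (w v : ℝ) +
        ∑ E ∈ R, ∏ v ∈ E, (w v : ℝ)
      ≤ ((n : ℝ) ^ k * ((1 - S / n) / k) ^ k) *
          ((n : ℝ) ^ 2 * (((S / n) ^ 2 - (k + 1) * (U / (k + 1) / n) ^ 2) / 2)) +
        (n : ℝ) ^ (k + 2) *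
          ((U / (k + 1) / n) ^ (k + 1) * (S / n - (k + 1) * (U / (k + 1) / n))) :=
        add_le_add (mul_le_mul h1 h2 (by positivity) (le_trans (by positivity) h1)) h3
    _ = (n : ℝ) ^ (k + 2) * (((1 - S / n) / k) ^ k *
          (((S / n) ^ 2 - (k + 1) * (U / (k + 1) / n) ^ 2) / 2) +
          (U / (k + 1) / n) ^ (k + 1) * (S / n - (k + 1) * (U / (k + 1) / n))) := by ring
    _ ≤ (n : ℝ) ^ (k + 2) * (2 / ((k : ℝ) + 2) ^ (k + 2)) := by gcongr
    _ = _ := by ring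

/-! ### The deletion method and existence of sparse families -/

theorem sum_biUnion_le_sum_sum {α β : Type*} [DecidableEq β] (s : Finset α) (t : α → Finset β)
    (f : β → ℝ) (hf : ∀ b, 0 ≤ f b) : ∑ b ∈ s.biUnion t, f b ≤ ∑ a ∈ s, ∑ b ∈ t a, f b := by
  classical
  induction s using Finset.induction_on with
  | empty => simp
  | insert a s ha ih =>
    rw [Finset.biUnion_insert, Finset.sum_insert ha]
    have h := Finset.sum_union_inter (s₁ := t a) (s₂ := s.biUnion t) (f := f)
    have h2 : 0 ≤ ∑ b ∈ t a ∩ s.biUnion t, f b := Finset.sum_nonneg fun b _ => hf b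
    linarith

/-- The deletion method: keep each element of `E` with probability `1 / Q`, then remove an element
from every forbidden set that survives. -/
theorem exists_subset_avoiding {α : Type*} [DecidableEq α] (E : Finset α)
    (B : Finset (Finset α)) (hB : ∀ b ∈ B, b.Nonempty) (hBE : ∀ b ∈ B, b ⊆ E) {Q : ℕ} (hQ : 0 < Q) :
    ∃ R ⊆ E, (∀ b ∈ B, ¬ b ⊆ R) ∧
      (E.card : ℝ) / Q - ∑ b ∈ B, (1 / (Q : ℝ)) ^ b.card ≤ R.card := by
  have : NeZero Q := ⟨hQ.ne'⟩
  have hQ0 : (0 : ℝ) < Q := by exact_mod_cast hQ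
  -- Probabilities are counts over all Q^|E| functions f, with e kept when f e = 0.
  have hcount : ∀ b ⊆ E, ((Finset.univ.filter fun f : E → Fin Q => ∀ e : E, e.1 ∈ b → f e = 0).card
      : ℝ) = (1 / (Q : ℝ)) ^ b.card * (Q : ℝ) ^ E.card := by
    intro b hb
    have h1 : (Finset.univ.filter fun f : E → Fin Q => ∀ e : E, e.1 ∈ b → f e = 0) =
        Fintype.piFinset fun e : E => if e.1 ∈ b then {0} else Finset.univ := by
      ext f
      simp only [Finset.mem_filter, Finset.mem_univ, true_and, Fintype.mem_piFinset]
      refine forall_congr' fun e => ?_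
      split_ifs with h <;> simp [h]
    rw [h1, Fintype.card_piFinset]
    have h2 : ∀ e : E, (if e.1 ∈ b then ({0} : Finset (Fin Q)) else Finset.univ).card =
        if e.1 ∈ b then 1 else Q := by
      intro e; split_ifs <;> simp
    rw [Finset.prod_congr rfl fun e _ => h2 e, Finset.prod_coe_sort E fun e => if e ∈ b then 1 else Q,
      Finset.prod_ite, Finset.prod_const_one, one_mul, Finset.prod_const]
    have h3 : (E.filter (· ∉ b)).card + b.card = E.card := by
      rw [Finset.filter_notMem_eq_sdiff, Finset.card_sdiff_add_card_eq_card hb]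
    rw [← h3, Nat.cast_pow, pow_add, div_pow, one_pow]
    field_simp
  set K : (E → Fin Q) → Finset α := fun f => E.filter fun e => ∃ h : e ∈ E, f ⟨e, h⟩ = 0 with hK
  have hKsub : ∀ b ⊆ E, ∀ f, b ⊆ K f ↔ ∀ e : E, e.1 ∈ b → f e = 0 := by
    intro b hb f
    constructor
    · intro h e he
      obtain ⟨-, h', hf⟩ := Finset.mem_filter.1 (h he)
      exact hf
    · intro h e he
      exact Finset.mem_filter.2 ⟨hb he, hb he, h ⟨e, hb he⟩ he⟩
  have hcount' : ∀ b ⊆ E, ((Finset.univ.filter fun f : E → Fin Q => b ⊆ K f).card : ℝ) =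
      (1 / (Q : ℝ)) ^ b.card * (Q : ℝ) ^ E.card := by
    intro b hb
    rw [← hcount b hb]
    simp only [hKsub b hb]
  obtain ⟨f, hf⟩ : ∃ f : E → Fin Q, (E.card : ℝ) / Q - ∑ b ∈ B, (1 / (Q : ℝ)) ^ b.card ≤
      (K f).card - (B.filter (· ⊆ K f)).card := by
    have hsum : ∑ f : E → Fin Q, ((E.card : ℝ) / Q - ∑ b ∈ B, (1 / (Q : ℝ)) ^ b.card) ≤
        ∑ f : E → Fin Q, (((K f).card : ℝ) - (B.filter (· ⊆ K f)).card) := by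
      have e1 : ∑ f : E → Fin Q, ((K f).card : ℝ) = E.card / Q * (Q : ℝ) ^ E.card := by
        have : ∀ f, ((K f).card : ℝ) = ∑ e ∈ E, if {e} ⊆ K f then (1 : ℝ) else 0 := by
          intro f
          rw [Finset.sum_boole]
          congr 2
          ext e
          simp only [hK, Finset.mem_filter, Finset.singleton_subset_iff]
          tauto
        simp only [this]
        rw [Finset.sum_comm]
        simp only [Finset.sum_boole]
        rw [Finset.sum_congr rfl fun e he => hcount' {e} (Finset.singleton_subset_iff.2 he)]
        simp
        ring
      have e2 : ∑ f : E → Fin Q, ((B.filter (· ⊆ K f)).card : ℝ) =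
          (∑ b ∈ B, (1 / (Q : ℝ)) ^ b.card) * (Q : ℝ) ^ E.card := by
        simp only [Finset.card_filter, Nat.cast_sum, Nat.cast_ite, Nat.cast_one, Nat.cast_zero]
        rw [Finset.sum_comm, Finset.sum_mul]
        refine Finset.sum_congr rfl fun b hb => ?_
        rw [Finset.sum_boole, hcount' b (hBE b hb)]
      rw [Finset.sum_const, Finset.sum_sub_distrib (fun f => ((K f).card : ℝ)), e1, e2,
        Finset.card_univ, Fintype.card_fun, Fintype.card_fin, Fintype.card_coe, nsmul_eq_mul,
        Nat.cast_pow]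
      apply le_of_eq
      ring
    obtain ⟨f, -, hf⟩ := Finset.exists_le_of_sum_le Finset.univ_nonempty hsum
    exact ⟨f, hf⟩
  rcases B.eq_empty_or_nonempty with rfl | ⟨b₀, hb₀⟩
  · exact ⟨K f, Finset.filter_subset _ _, by simp, by simpa using hf⟩
  have : Nonempty α := ⟨(hB b₀ hb₀).choose⟩
  choose! g hg using hB
  set D := (B.filter (· ⊆ K f)).image g
  refine ⟨K f \ D, Finset.sdiff_subset.trans (Finset.filter_subset _ _), ?_, hf.trans ?_⟩
  · intro b hb hbR
    have h1 : b ⊆ K f := hbR.trans Finset.sdiff_subset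
    have h2 := hbR (hg b hb)
    rw [Finset.mem_sdiff] at h2
    exact h2.2 (Finset.mem_image_of_mem _ (Finset.mem_filter.2 ⟨hb, h1⟩))
  · have h1 : (K f).card ≤ (K f \ D).card + (B.filter (· ⊆ K f)).card := by
      have := Finset.le_card_sdiff D (K f)
      have : D.card ≤ _ := Finset.card_image_le
      omega
    have h2 : ((K f).card : ℝ) ≤ (K f \ D).card + (B.filter (· ⊆ K f)).card := by exact_mod_cast h1
    linarith

/-- The forbidden configurations are j - k edges inside j vertices. With edge probability 1/Q and m
= 2DQ vertices, their expected number is at most M·Q^k, while at least 2t^(k+1) edges are expected.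
-/
theorem exists_isLocallySparse (k n : ℕ) :
    ∃ t : ℕ, k + 1 ≤ 2 * t ∧ ∃ R : Finset (Finset (Fin (2 * t))),
      (∀ E ∈ R, E.card = k + 2) ∧ IsLocallySparse (k + 1) n R ∧ t ^ (k + 1) < R.card := by
  -- The factor (k+2)! absorbs the denominator of C(m, k+2); the 2 leaves t^(k+1) edges to spare for
  -- deletion.
  set D := 2 * (k + 2).factorial with hD
  have hD0 : 0 < D := by positivity
  set M := ∑ j ∈ Finset.Icc (k + 2) n, (2 * D) ^ j * ((j.choose (k + 2)).choose (j - k)) with hM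
  -- M does not involve Q, so Q > M can be imposed, giving M·Q^k < Q^(k+1) ≤ t^(k+1).
  set Q := M + k + 2 with hQ
  have hQ0 : 0 < Q := by omega
  have hDQ : Q ≤ D * Q := Nat.le_mul_of_pos_left _ hD0
  refine ⟨D * Q, by omega, ?_⟩
  set m := 2 * (D * Q) with hm
  set C : ℕ → Finset (Fin m) → Finset (Finset (Finset (Fin m))) :=
    fun j S => (S.powersetCard (k + 2)).powersetCard (j - k) with hC
  set B := (Finset.Icc (k + 2) n).biUnion fun j => (Finset.univ.powersetCard j).biUnion (C j) with hB
  have memB : ∀ b, b ∈ B ↔ ∃ j, (k + 2 ≤ j ∧ j ≤ n) ∧ ∃ S : Finset (Fin m), S.card = j ∧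
      b ⊆ S.powersetCard (k + 2) ∧ b.card = j - k := by
    intro b
    simp only [hB, hC, Finset.mem_biUnion, Finset.mem_Icc, Finset.mem_powersetCard,
      Finset.subset_univ, true_and]
  obtain ⟨R, hRE, hRB, hRcard⟩ := exists_subset_avoiding (Finset.univ.powersetCard (k + 2)) B
    (fun b hb => by
      obtain ⟨j, hj, S, -, -, hb⟩ := (memB b).1 hb
      rw [← Finset.card_pos]; omega)
    (fun b hb => by
      obtain ⟨j, hj, S, -, hb, -⟩ := (memB b).1 hb
      exact hb.trans (Finset.powersetCard_mono (Finset.subset_univ _))) hQ0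
  have hcard : ∀ E ∈ R, E.card = k + 2 := fun E hE => (Finset.mem_powersetCard.1 (hRE hE)).2
  refine ⟨R, hcard, ?_, ?_⟩
  · intro S hS
    rcases Nat.lt_or_ge S.card (k + 2) with hlt | hge
    · rw [Finset.filter_eq_empty_iff.2, Finset.card_empty]
      · exact Nat.zero_le _
      · intro E hE hES
        have := Finset.card_le_card hES
        rw [hcard E hE] at this
        omega
    · by_contra! h
      obtain ⟨b, hb, hbc⟩ := Finset.exists_subset_card_eq (s := R.filter (· ⊆ S)) (n := S.card - k)
        (by omega)
      refine hRB b ((memB b).2 ⟨S.card, ⟨hge, hS⟩, S, rfl, fun E hE => ?_, hbc⟩)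
        (hb.trans (Finset.filter_subset _ _))
      obtain ⟨h1, h2⟩ := Finset.mem_filter.1 (hb hE)
      exact Finset.mem_powersetCard.2 ⟨h2, hcard E h1⟩
  · have hQr : (0 : ℝ) < Q := by exact_mod_cast hQ0
    have hsum : ∑ b ∈ B, (1 / (Q : ℝ)) ^ b.card ≤ M * (Q : ℝ) ^ k := by
      have nn : ∀ b : Finset (Finset (Fin m)), 0 ≤ (1 / (Q : ℝ)) ^ b.card := fun b => by positivity
      calc ∑ b ∈ B, (1 / (Q : ℝ)) ^ b.card
          ≤ ∑ j ∈ Finset.Icc (k + 2) n, ∑ b ∈ (Finset.univ.powersetCard j).biUnion (C j),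
              (1 / (Q : ℝ)) ^ b.card := sum_biUnion_le_sum_sum _ _ _ nn
        _ ≤ ∑ j ∈ Finset.Icc (k + 2) n, ∑ S ∈ (Finset.univ : Finset (Fin m)).powersetCard j,
              ∑ b ∈ C j S, (1 / (Q : ℝ)) ^ b.card :=
            Finset.sum_le_sum fun j _ => sum_biUnion_le_sum_sum _ _ _ nn
        _ ≤ ∑ j ∈ Finset.Icc (k + 2) n,
              (2 * D : ℝ) ^ j * ((j.choose (k + 2)).choose (j - k)) * (Q : ℝ) ^ k := by
            refine Finset.sum_le_sum fun j hj => ?_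
            rw [Finset.mem_Icc] at hj
            have h1 : ∀ S ∈ (Finset.univ : Finset (Fin m)).powersetCard j,
                ∑ b ∈ C j S, (1 / (Q : ℝ)) ^ b.card =
                  ((j.choose (k + 2)).choose (j - k)) * (1 / (Q : ℝ)) ^ (j - k) := by
              intro S hS
              rw [Finset.sum_congr rfl fun b hb => by rw [(Finset.mem_powersetCard.1 hb).2],
                Finset.sum_const, Finset.card_powersetCard, Finset.card_powersetCard,
                (Finset.mem_powersetCard.1 hS).2, nsmul_eq_mul]
            rw [Finset.sum_congr rfl h1, Finset.sum_const, Finset.card_powersetCard,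
              Finset.card_univ, Fintype.card_fin, nsmul_eq_mul]
            have h2 : (m.choose j : ℝ) ≤ (2 * D : ℝ) ^ j * (Q : ℝ) ^ j := by
              rw [← mul_pow]
              calc (m.choose j : ℝ) ≤ (m ^ j : ℕ) := by exact_mod_cast Nat.choose_le_pow m j
                _ = _ := by rw [hm]; push_cast; ring
            have h3 : (Q : ℝ) ^ j * (1 / (Q : ℝ)) ^ (j - k) = (Q : ℝ) ^ k := by
              have : (Q : ℝ) ^ j = (Q : ℝ) ^ k * (Q : ℝ) ^ (j - k) := by
                rw [← pow_add]; congr 1; omega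
              rw [this, mul_assoc, ← mul_pow, mul_one_div_cancel hQr.ne', one_pow, mul_one]
            calc (m.choose j : ℝ) * (((j.choose (k + 2)).choose (j - k)) * (1 / (Q : ℝ)) ^ (j - k))
                ≤ ((2 * D : ℝ) ^ j * (Q : ℝ) ^ j) *
                  (((j.choose (k + 2)).choose (j - k)) * (1 / (Q : ℝ)) ^ (j - k)) := by gcongr
              _ = (2 * D : ℝ) ^ j * ((j.choose (k + 2)).choose (j - k)) *
                  ((Q : ℝ) ^ j * (1 / (Q : ℝ)) ^ (j - k)) := by ring
              _ = _ := by rw [h3]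
        _ = M * (Q : ℝ) ^ k := by rw [← Finset.sum_mul, hM]; push_cast; rfl
    have hE : 2 * ((D : ℝ) * Q) ^ (k + 1) ≤
        ((Finset.univ : Finset (Fin m)).powersetCard (k + 2)).card / Q := by
      rw [Finset.card_powersetCard, Finset.card_univ, Fintype.card_fin, le_div_iff₀ hQr]
      have h1 := Nat.pow_le_choose (α := ℝ) (k + 2) m
      refine le_trans ?_ h1
      rw [le_div_iff₀ (by positivity)]
      have h2 : D * Q ≤ m + 1 - (k + 2) := by omega
      have h3 : (D : ℝ) * Q ≤ ((m + 1 - (k + 2) : ℕ) : ℝ) := by exact_mod_cast h2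
      calc 2 * ((D : ℝ) * Q) ^ (k + 1) * Q * (k + 2).factorial
          = ((D : ℝ) * Q) ^ (k + 1) * ((2 * (k + 2).factorial : ℕ) * Q) := by push_cast; ring
        _ = ((D : ℝ) * Q) ^ (k + 2) := by rw [← hD]; ring
        _ ≤ _ := by gcongr
    have hlt : (M : ℝ) * (Q : ℝ) ^ k < ((D : ℝ) * Q) ^ (k + 1) := by
      have h1 : (M : ℝ) < Q := by exact_mod_cast (by omega : M < Q)
      have h2 : (Q : ℝ) ≤ D * Q := by exact_mod_cast hDQ
      calc (M : ℝ) * (Q : ℝ) ^ k < Q * (Q : ℝ) ^ k := by gcongr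
        _ = (Q : ℝ) ^ (k + 1) := by ring
        _ ≤ _ := by gcongr
    have : ((D : ℝ) * Q) ^ (k + 1) < R.card := by linarith
    exact_mod_cast this

/-! ### Blow-ups of patterns and their edge counts -/

/-- The subsets of `W` that `c` maps bijectively onto a member of `P`. -/
def transversals {V I : Type*} [DecidableEq V] [DecidableEq I] (c : V → I) (P : Finset (Finset I))
    (W : Finset V) : Finset (Finset V) :=
  W.powerset.filter fun e => e.image c ∈ P ∧ (e.image c).card = e.card

/-- A transversal over p amounts to choosing one vertex of W from each class in p. -/
theorem card_transversals_singleton {V I : Type*} [DecidableEq V] [DecidableEq I] (c : V → I)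
    (p : Finset I) (W : Finset V) :
    (transversals c {p} W).card = ∏ i ∈ p, (W.filter (c · = i)).card := by
  rw [← Finset.card_pi]
  symm
  have hc : ∀ f ∈ p.pi fun i => W.filter (c · = i), ∀ i (hi : i ∈ p), c (f i hi) = i :=
    fun f hf i hi => (Finset.mem_filter.1 (Finset.mem_pi.1 hf i hi)).2
  refine Finset.card_bij (fun f _ => p.attach.image fun i => f i.1 i.2) ?_ ?_ ?_
  · intro f hf
    have h1 : (p.attach.image fun i => f i.1 i.2).image c = p := by
      rw [Finset.image_image]
      ext i
      simp only [Finset.mem_image, Finset.mem_attach, true_and, Function.comp_apply,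
        Subtype.exists]
      constructor
      · rintro ⟨j, hj, rfl⟩
        rwa [hc f hf]
      · exact fun hi => ⟨i, hi, hc f hf i hi⟩
    simp only [transversals, Finset.mem_filter, Finset.mem_powerset, Finset.mem_singleton]
    refine ⟨?_, h1, ?_⟩
    · intro v hv
      obtain ⟨i, -, rfl⟩ := Finset.mem_image.1 hv
      exact (Finset.mem_filter.1 (Finset.mem_pi.1 hf i.1 i.2)).1
    · refine le_antisymm Finset.card_image_le ?_
      rw [h1]
      exact Finset.card_image_le.trans_eq p.card_attach
  · intro f hf g hg h
    funext i hi
    have : f i hi ∈ p.attach.image fun i => g i.1 i.2 := by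
      rw [← h]
      exact Finset.mem_image.2 ⟨⟨i, hi⟩, Finset.mem_attach _ _, rfl⟩
    obtain ⟨⟨j, hj⟩, -, hij⟩ := Finset.mem_image.1 this
    have h2 : j = i := by
      rw [← hc f hf i hi, ← hij, hc g hg]
    subst h2
    exact hij.symm
  · intro e he
    simp only [transversals, Finset.mem_filter, Finset.mem_powerset, Finset.mem_singleton] at he
    obtain ⟨heW, hep, hcard⟩ := he
    have hinj := Finset.card_image_iff.1 hcard
    have hex : ∀ i ∈ p, ∃ v ∈ e, c v = i := fun i hi => by
      rw [← hep] at hi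
      exact Finset.mem_image.1 hi
    choose f hfe hfc using hex
    refine ⟨f, Finset.mem_pi.2 fun i hi =>
      Finset.mem_filter.2 ⟨heW (hfe i hi), hfc i hi⟩, ?_⟩
    ext v
    simp only [Finset.mem_image, Finset.mem_attach, true_and, Subtype.exists]
    constructor
    · rintro ⟨i, hi, rfl⟩
      exact hfe i hi
    · intro hv
      have hi : c v ∈ p := hep ▸ Finset.mem_image_of_mem c hv
      exact ⟨c v, hi, hinj (hfe _ hi) hv (hfc _ hi)⟩

theorem card_transversals {V I : Type*} [DecidableEq V] [DecidableEq I] (c : V → I)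
    (P : Finset (Finset I)) (W : Finset V) :
    (transversals c P W).card = ∑ p ∈ P, ∏ i ∈ p, (W.filter (c · = i)).card := by
  rw [Finset.card_eq_sum_card_fiberwise (f := Finset.image c) (t := P)
    fun e he => (Finset.mem_filter.1 he).2.1]
  refine Finset.sum_congr rfl fun p hp => ?_
  rw [← card_transversals_singleton]
  congr 1
  ext e
  simp only [transversals, Finset.mem_filter, Finset.mem_singleton]
  constructor
  · rintro ⟨⟨h1, -, h2⟩, h3⟩
    exact ⟨h1, h3, h2⟩
  · rintro ⟨h1, h2, h3⟩
    exact ⟨⟨h1, h2 ▸ hp, h3⟩, h2⟩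

/-- The edges `univ ∪ {y, y'}` with `y ≠ y'` on the right, and the members of `R` on the right. -/
def pairPattern (k : ℕ) {ι : Type*} [Fintype ι] [DecidableEq ι] (R : Finset (Finset ι)) :
    Finset (Finset (Fin k ⊕ ι)) :=
  (Finset.univ.powersetCard 2).image (Finset.univ.disjSum ·) ∪ R.image (Finset.disjSum ∅ ·)

theorem card_of_mem_pairPattern {k : ℕ} {ι : Type*} [Fintype ι] [DecidableEq ι]
    {R : Finset (Finset ι)} (hR : ∀ E ∈ R, E.card = k + 2) {p : Finset (Fin k ⊕ ι)}
    (hp : p ∈ pairPattern k R) : p.card = k + 2 := by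
  rcases Finset.mem_union.1 hp with hp | hp
  · obtain ⟨s, hs, rfl⟩ := Finset.mem_image.1 hp
    rw [Finset.card_disjSum, (Finset.mem_powersetCard.1 hs).2, Finset.card_univ, Fintype.card_fin]
  · obtain ⟨s, hs, rfl⟩ := Finset.mem_image.1 hp
    rw [Finset.card_disjSum, hR s hs, Finset.card_empty, zero_add]

theorem sum_pairPattern {k : ℕ} (hk : 0 < k) {ι : Type*} [Fintype ι] [DecidableEq ι]
    (R : Finset (Finset ι)) (w : Fin k ⊕ ι → ℕ) :
    ∑ p ∈ pairPattern k R, ∏ i ∈ p, w i =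
      (∏ j, w (.inl j)) * ∑ p ∈ Finset.univ.powersetCard 2, ∏ v ∈ p, w (.inr v) +
        ∑ E ∈ R, ∏ v ∈ E, w (.inr v) := by
  have hinj : ∀ s : Finset (Fin k), Function.Injective (fun t : Finset ι => s.disjSum t) := by
    intro s t t' h
    ext v
    have := congrArg (Sum.inr v ∈ ·) h
    simpa using this
  rw [pairPattern, Finset.sum_union, Finset.sum_image (hinj _).injOn,
    Finset.sum_image (hinj _).injOn, Finset.mul_sum]
  · simp only [Finset.prod_disjSum, Finset.prod_empty, one_mul]
  · rw [Finset.disjoint_left]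
    intro p hp hp'
    obtain ⟨s, -, rfl⟩ := Finset.mem_image.1 hp
    obtain ⟨s', -, h⟩ := Finset.mem_image.1 hp'
    -- As k > 0, edges of the first kind have a left vertex and members of `R` have none.
    have := congrArg (Sum.inl (⟨0, hk⟩ : Fin k) ∈ ·) h
    simp at this

/-- The blow-up of the pattern `P` along the class map `c`. -/
def blowup {V I : Type*} [Fintype V] [DecidableEq V] [DecidableEq I] (c : V → I)
    (P : Finset (Finset I)) : Hypergraph V where
  vertexSet := Set.univ
  edgeSet := (fun e : Finset V => (e : Set V)) '' (transversals c P Finset.univ : Set (Finset V))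
  subset_vertexSet_of_mem_edgeSet' _ _ := Set.subset_univ _

theorem ncard_edgeSet_blowup {V I : Type*} [Fintype V] [DecidableEq V] [DecidableEq I]
    (c : V → I) (P : Finset (Finset I)) :
    (blowup c P).edgeSet.ncard = ∑ p ∈ P, ∏ i ∈ p, (Finset.univ.filter (c · = i)).card := by
  rw [blowup, Set.ncard_image_of_injective _ Finset.coe_injective, Set.ncard_coe_finset,
    card_transversals]

theorem isRGraph_blowup {V I : Type*} [Fintype V] [DecidableEq V] [DecidableEq I]
    (c : V → I) {P : Finset (Finset I)} {r : ℕ} (hP : ∀ p ∈ P, p.card = r) :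
    (blowup c P).IsRGraph r := by
  refine ⟨Set.finite_univ, ?_⟩
  rintro _ ⟨e, he, rfl⟩
  obtain ⟨-, h1, h2⟩ := Finset.mem_filter.1 he
  rw [Set.ncard_coe_finset, ← h2, hP _ h1]

theorem ncard_edgeSet_le_of_isSubgraph_blowup {V I : Type*} [Fintype V] [DecidableEq V]
    [DecidableEq I] (c : V → I) (P : Finset (Finset I)) {H : Hypergraph V}
    (hH : H.IsSubgraph (blowup c P)) {W : Finset V} (hW : (W : Set V) = H.vertexSet) :
    H.edgeSet.ncard ≤ ∑ p ∈ P, ∏ i ∈ p, (W.filter (c · = i)).card := by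
  rw [← card_transversals, ← Set.ncard_coe_finset (transversals c P W),
    ← Set.ncard_image_of_injective _ Finset.coe_injective]
  refine Set.ncard_le_ncard ?_ ((Finset.finite_toSet _).image _)
  intro e he
  obtain ⟨e', he', rfl⟩ := hH.2 he
  have h1 := Hypergraph.subset_vertexSet_of_mem_edgeSet he
  rw [← hW, Finset.coe_subset] at h1
  exact ⟨e', Finset.mem_filter.2 ⟨Finset.mem_powerset.2 h1, (Finset.mem_filter.1 he').2⟩, rfl⟩

/-! ### Asymptotics and the final contradiction -/

theorem exists_pow_div_choose_lt (r : ℕ) {δ : ℝ} (hδ : 0 < δ) :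
    ∃ n : ℕ, r ≤ n ∧ 2 * (n : ℝ) ^ r / (r : ℝ) ^ r / (n.choose r : ℝ) <
      2 * (r.factorial : ℝ) / (r : ℝ) ^ r + δ := by
  have h1 : Filter.Tendsto ((fun n : ℕ => (n : ℝ) ^ r / r.factorial) /
      fun n : ℕ => (n.choose r : ℝ)) Filter.atTop (nhds 1) := by
    rw [← Asymptotics.isEquivalent_iff_tendsto_one]
    · exact (isEquivalent_choose r).symm
    · filter_upwards [Filter.eventually_ge_atTop r] with n hn
      exact_mod_cast (Nat.choose_pos hn).ne'
  have h2 := h1.const_mul (2 * (r.factorial : ℝ) / (r : ℝ) ^ r)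
  rw [mul_one] at h2
  obtain ⟨n, hn, hrn⟩ := ((h2.eventually_lt_const (lt_add_of_pos_right _ hδ)).and
    (Filter.eventually_ge_atTop r)).exists
  refine ⟨n, hrn, lt_of_eq_of_lt ?_ hn⟩
  have : (r.factorial : ℝ) ≠ 0 := by positivity
  simp only [Pi.div_apply]
  field_simp

theorem two_mul_factorial_lt_pow {r : ℕ} (hr : 3 ≤ r) : 2 * r.factorial < r ^ r := by
  have h : ∀ n : ℕ, (n + 1).factorial ≤ (n + 1) ^ n := by
    intro n
    induction n with
    | zero => simp
    | succ n ih =>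
      calc (n + 1 + 1).factorial = (n + 1 + 1) * (n + 1).factorial := Nat.factorial_succ _
        _ ≤ (n + 1 + 1) * (n + 1 + 1) ^ n := by
          gcongr
          exact ih.trans (Nat.pow_le_pow_left (by omega) _)
        _ = _ := by ring
  obtain ⟨n, rfl⟩ : ∃ n, r = n + 1 := ⟨r - 1, by omega⟩
  calc 2 * (n + 1).factorial ≤ 2 * (n + 1) ^ n := by gcongr; exact h n
    _ < (n + 1) * (n + 1) ^ n := by gcongr; omega
    _ = _ := by ring

/-- The class map of the blow-up with left classes of size `a` and right classes of size `q`. -/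
abbrev classMap (k a m q : ℕ) : (Fin k × Fin a) ⊕ (Fin m × Fin q) → Fin k ⊕ Fin m :=
  Sum.map Prod.fst Prod.fst

theorem card_classMap_inl (k a m q : ℕ) (j : Fin k) :
    (Finset.univ.filter (classMap k a m q · = .inl j)).card = a := by
  have : Finset.univ.filter (classMap k a m q · = .inl j) =
      Finset.univ.image fun b : Fin a => Sum.inl (j, b) := by
    ext x
    rcases x with ⟨x, y⟩ | ⟨x, y⟩ <;> simp [eq_comm]
  rw [this, Finset.card_image_of_injective, Finset.card_univ, Fintype.card_fin]
  intro b b' h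
  simpa using h

theorem card_classMap_inr (k a m q : ℕ) (v : Fin m) :
    (Finset.univ.filter (classMap k a m q · = .inr v)).card = q := by
  have : Finset.univ.filter (classMap k a m q · = .inr v) =
      Finset.univ.image fun b : Fin q => Sum.inr (v, b) := by
    ext x
    rcases x with ⟨x, y⟩ | ⟨x, y⟩ <;> simp [eq_comm]
  rw [this, Finset.card_image_of_injective, Finset.card_univ, Fintype.card_fin]
  intro b b' h
  simpa using h

theorem not_isJump (k : ℕ) (hk : 2 ≤ k) :
    ¬ IsJump (k + 2) (2 * ((k + 2).factorial : ℝ) / ((k + 2 : ℕ) : ℝ) ^ (k + 2)) := by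
  rintro ⟨δ, hδ, h⟩
  obtain ⟨n, hn, hlt⟩ := exists_pow_div_choose_lt (k + 2) hδ
  obtain ⟨t, ht, R, hRcard, hR, htR⟩ := exists_isLocallySparse k n
  have ht0 : 0 < t := by omega
  have ht0' : (0 : ℝ) < t := by exact_mod_cast ht0
  set r : ℝ := ((k + 2 : ℕ) : ℝ) with hr
  have hr0 : 0 < r := by rw [hr]; positivity
  -- This ε is worth one pattern edge: q^r edges out of (rtq)^r/r!.
  obtain ⟨N, hN⟩ := h ((k + 2).factorial / (r * t) ^ (k + 2)) (by positivity) n hn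
  set q := N + 1 with hq
  have hq0 : (0 : ℝ) < q := by rw [hq]; positivity
  set c := classMap k (t * q) (2 * t) q with hc
  set P := pairPattern k R
  have horder : (blowup c P).order = (k + 2) * (t * q) := by
    rw [Hypergraph.order, blowup, Set.ncard_univ, Nat.card_eq_fintype_card]
    simp only [Fintype.card_sum, Fintype.card_prod, Fintype.card_fin]
    ring
  have hqt : q ≤ t * q := Nat.le_mul_of_pos_left _ ht0
  have horderN : N ≤ (blowup c P).order := by rw [horder]; nlinarith
  have hdens : 2 * ((k + 2).factorial : ℝ) / r ^ (k + 2) + (k + 2).factorial / (r * t) ^ (k + 2) ≤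
      (blowup c P).density (k + 2) := by
    rw [Hypergraph.density, ncard_edgeSet_blowup, sum_pairPattern (by omega), horder]
    simp only [hc, card_classMap_inl, card_classMap_inr, Finset.prod_const, Finset.card_univ,
      Fintype.card_fin]
    rw [Finset.sum_congr rfl fun p hp => by rw [(Finset.mem_powersetCard.1 hp).2],
      Finset.sum_congr (s₁ := R) rfl fun E hE => by rw [hRcard E hE],
      Finset.sum_const, Finset.sum_const, Finset.card_powersetCard, Finset.card_univ,
      Fintype.card_fin, le_div_iff₀ (by
        have : k + 2 ≤ (k + 2) * (t * q) := Nat.le_mul_of_pos_right _ (by omega)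
        exact_mod_cast Nat.choose_pos this)]
    have h1 : (((k + 2) * (t * q)).choose (k + 2) : ℝ) ≤
        (r * t * q) ^ (k + 2) / (k + 2).factorial := by
      refine (Nat.choose_le_pow_div _ _).trans_eq ?_
      rw [hr]; push_cast; ring
    have h2 : (t : ℝ) ^ (k + 1) + 1 ≤ R.card := by exact_mod_cast htR
    calc (2 * ((k + 2).factorial : ℝ) / r ^ (k + 2) + (k + 2).factorial / (r * t) ^ (k + 2)) *
          (((k + 2) * (t * q)).choose (k + 2) : ℝ)
        ≤ (2 * ((k + 2).factorial : ℝ) / r ^ (k + 2) + (k + 2).factorial / (r * t) ^ (k + 2)) *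
          ((r * t * q) ^ (k + 2) / (k + 2).factorial) := by gcongr
      _ = (2 * (t : ℝ) ^ (k + 2) + 1) * (q : ℝ) ^ (k + 2) := by
          have : ((k + 2).factorial : ℝ) ≠ 0 := by positivity
          simp only [mul_pow]
          field_simp
      -- The deficit comes from t^k·C(2t,2) = 2t^(k+2) - t^(k+1); |R| ≥ t^(k+1) + 1 repays it with
      -- one to spare.
      _ ≤ (2 * (t : ℝ) ^ (k + 2) - t ^ (k + 1) + R.card) * (q : ℝ) ^ (k + 2) := by
          exact mul_le_mul_of_nonneg_right (by linarith) (by positivity)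
      _ = _ := by
          push_cast [nsmul_eq_mul, Nat.cast_choose_two]
          ring
  obtain ⟨H, hHG, hHn, hHd⟩ := hN _ (blowup c P)
    (isRGraph_blowup c fun p hp => card_of_mem_pairPattern hRcard hp) horderN hdens
  refine absurd hHd (not_le.2 (lt_of_le_of_lt ?_ hlt))
  classical
  set W := H.vertexSet.toFinset with hWdef
  have hW : (W : Set _) = H.vertexSet := Set.coe_toFinset _
  have hWn : W.card = n := by
    rw [← hHn, Hypergraph.order, ← hW, Set.ncard_coe_finset]
  have h1 := ncard_edgeSet_le_of_isSubgraph_blowup c P hHG hW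
  rw [sum_pairPattern (by omega)] at h1
  have h2 := hR.pattern_sum_le hk (by omega) hRcard (by simpa using ht)
    (fun j => (W.filter (c · = .inl j)).card) (fun v => (W.filter (c · = .inr v)).card) (by
      rw [← hWn, Finset.card_eq_sum_card_fiberwise (f := c) (t := Finset.univ) (by simp),
        Fintype.sum_sum_type])
  rw [Hypergraph.density, hHn]
  gcongr
  refine le_trans (by exact_mod_cast h1) (h2.trans_eq ?_)
  rw [hr]; push_cast; rfl

theorem mainTheorem3 (r : ℕ) (hr : 4 ≤ r) :
    2 * (r.factorial : ℝ) / (r : ℝ) ^ r ∈ Set.Ico (0 : ℝ) 1 ∧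
      ¬ IsJump r (2 * (r.factorial : ℝ) / (r : ℝ) ^ r) := by
  refine ⟨⟨by positivity, ?_⟩, ?_⟩
  · rw [div_lt_one (by positivity)]
    exact_mod_cast two_mul_factorial_lt_pow (by omega)
  · obtain ⟨k, rfl⟩ : ∃ k, r = k + 2 := ⟨r - 2, by omega⟩
    exact not_isJump k (by omega)
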